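/- Let $\alpha\in(0,1]$ and set $$\zeta_\alpha:=\Big(\tfrac{2\alpha}{1-\alpha}\Big)^{1-\alpha}+2\Big(\tfrac{2\alpha}{1-\alpha}\Big)^{-\alpha}\ (\alpha<1),\qquad \zeta_1:=1,\qquad g_\alpha:=\zeta_\alpha\,(1-\alpha)^{\frac{1-\alpha}{2}}\,\alpha^{\frac{\alpha}{2}}\quad(\text{with }0^0:=1).$$ For a family $(T_t)_{t\ge0}$ of bounded operators on a Banach space $X$ put $|x|_{F_\alpha}:=\sup_{t>0}\big\|t^{-\alpha}(T_tx-x)\big\|\in[0,\infty]$; the Favard space is $F_\alpha=F_\alpha((T_t)):=\{x\in X: |x|_{F_\alpha}<\infty\}$. (1) Let $(T_t)_{t\ge 0}$ be a strongly continuous contraction semigroup on a (real or complex) Banach space $X$, with generator $A$, i.e. $Ax=\lim_{t\downarrow0}\frac1t(T_tx-x)$ on the domain $D(A)$ of all $x$ for which this limit exists. Then every $\lambda>0$ belongs to the resolvent set of $A$, and for every $x\in X$, $$x\in F_\alpha\iff \sup_{\lambda>0}\big\|\lambda^\alpha A(\lambda I-A)^{-1}x\big\|<\infty,$$ in which case $$|x|_{F_\alpha}\le\zeta_\alpha\,\sup_{\lambda>0}\big\|\lambda^\alpha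 A(\lambda I-A)^{-1}x\big\|.$$ (2) Let $H$ be a (possibly unbounded) self-adjoint operator on a complex Hilbert space $\mathcal H$ with spectral measure $\mathcal E^H$, and let $e^{-itH}$ and $|H|^\alpha$ be defined by the functional calculus $f(H)=\int f\,d\mathcal E^H$, $D(f(H))=\{x:\int|f(s)|^2\,d\langle\mathcal E^H_sx,x\rangle<\infty\}$. Then every $x\in D(|H|^\alpha)$ belongs to the Favard space $F_\alpha$ of $T_t=e^{-itH}$, and $$|x|_{F_\alpha}\le g_\alpha\,\big\||H|^\alpha x\big\|.$$ -/

import Mathlib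

open MeasureTheory Filter Topology
open scoped ENNReal InnerProductSpace

noncomputable section

/-! ## Contraction semigroups, generators, resolvents -/

/-- `T` (restricted to times `t ≥ 0`) is a strongly continuous contraction semigroup on `X`.
No condition is imposed on `T t` for `t < 0`. -/
structure IsContractionSemigroup {𝕜 X : Type*} [RCLike 𝕜] [NormedAddCommGroup X]
    [NormedSpace 𝕜 X] (T : ℝ → X →L[𝕜] X) : Prop where
  map_zero : T 0 = 1
  map_add : ∀ s t : ℝ, 0 ≤ s → 0 ≤ t → T (s + t) = T s * T t
  contraction : ∀ t : ℝ, 0 ≤ t → ∀ x : X, ‖T t x‖ ≤ ‖x‖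
  strongly_continuous : ∀ x : X, Tendsto (fun t : ℝ => T t x) (𝓝[>] 0) (𝓝 x)

/-- The generator `A x = lim_{t ↓ 0} (T_t x - x) / t`, with domain the set of all `x` for which
this limit exists. -/
def semigroupGenerator {𝕜 X : Type*} [RCLike 𝕜] [NormedAddCommGroup X] [NormedSpace 𝕜 X]
    (T : ℝ → X →L[𝕜] X) : X →ₗ.[𝕜] X where
  domain :=
    { carrier := {x | ∃ y : X, Tendsto (fun t : ℝ => ((t : 𝕜)⁻¹) • (T t x - x)) (𝓝[>] 0) (𝓝 y)}
      zero_mem' := ⟨0, by simp⟩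
      add_mem' := by
        rintro a b ⟨y, hy⟩ ⟨z, hz⟩
        refine ⟨y + z, (hy.add hz).congr fun t => ?_⟩
        rw [← smul_add, map_add]
        congr 1
        abel
      smul_mem' := by
        rintro c a ⟨y, hy⟩
        refine ⟨c • y, (hy.const_smul c).congr fun t => ?_⟩
        rw [map_smul, ← smul_sub, smul_comm] }
  toFun :=
    { toFun := fun x => Classical.choose x.2
      map_add' := by
        intro a b
        refine tendsto_nhds_unique (Classical.choose_spec (a + b).2)
          (((Classical.choose_spec a.2).add (Classical.choose_spec b.2)).congr fun t => ?_)
        rw [← smul_add, Submodule.coe_add, map_add]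
        congr 1
        abel
      map_smul' := by
        intro c a
        refine tendsto_nhds_unique (Classical.choose_spec (c • a).2)
          (((Classical.choose_spec a.2).const_smul c).congr fun t => ?_)
        rw [Submodule.coe_smul, map_smul, ← smul_sub, smul_comm] }

/-- `R` is a bounded two-sided inverse of `z I - A : D(A) → X`. -/
def IsResolventAt {𝕜 X : Type*} [RCLike 𝕜] [NormedAddCommGroup X] [NormedSpace 𝕜 X]
    (A : X →ₗ.[𝕜] X) (z : 𝕜) (R : X →L[𝕜] X) : Prop :=
  (∀ y : X, ∃ h : R y ∈ A.domain, z • R y - A ⟨R y, h⟩ = y) ∧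
    ∀ x : A.domain, R (z • (x : X) - A x) = x

/-- The resolvent set of an unbounded operator `A`. -/
def unboundedResolventSet {𝕜 X : Type*} [RCLike 𝕜] [NormedAddCommGroup X] [NormedSpace 𝕜 X]
    (A : X →ₗ.[𝕜] X) : Set 𝕜 :=
  {z | ∃ R : X →L[𝕜] X, IsResolventAt A z R}

open Classical in
/-- The resolvent `(z I - A)⁻¹` for `z` in the resolvent set of `A` (and `0` elsewhere). -/
def unboundedResolvent {𝕜 X : Type*} [RCLike 𝕜] [NormedAddCommGroup X] [NormedSpace 𝕜 X]
    (A : X →ₗ.[𝕜] X) (z : 𝕜) : X →L[𝕜] X :=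
  if h : z ∈ unboundedResolventSet A then Classical.choose h else 0

theorem isResolventAt_unboundedResolvent {𝕜 X : Type*} [RCLike 𝕜] [NormedAddCommGroup X]
    [NormedSpace 𝕜 X] {A : X →ₗ.[𝕜] X} {z : 𝕜} (h : z ∈ unboundedResolventSet A) :
    IsResolventAt A z (unboundedResolvent A z) := by
  rw [unboundedResolvent, dif_pos h]
  exact Classical.choose_spec h

theorem unboundedResolvent_mem_domain {𝕜 X : Type*} [RCLike 𝕜] [NormedAddCommGroup X]
    [NormedSpace 𝕜 X] (A : X →ₗ.[𝕜] X) (z : 𝕜) (x : X) :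
    unboundedResolvent A z x ∈ A.domain := by
  by_cases h : z ∈ unboundedResolventSet A
  · exact ((isResolventAt_unboundedResolvent h).1 x).1
  · rw [unboundedResolvent, dif_neg h]
    exact A.domain.zero_mem

/-- The quantity `sup_{l > 0} ‖l ^ α • A (l I - A)⁻¹ x‖`, with values in `[0, ∞]`. -/
def resolventSup {𝕜 X : Type*} [RCLike 𝕜] [NormedAddCommGroup X] [NormedSpace 𝕜 X]
    (A : X →ₗ.[𝕜] X) (α : ℝ) (x : X) : ℝ≥0∞ :=
  ⨆ (l : ℝ) (_ : 0 < l),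
    ‖((l ^ α : ℝ) : 𝕜) •
      A ⟨unboundedResolvent A (l : 𝕜) x, unboundedResolvent_mem_domain A (l : 𝕜) x⟩‖ₑ

/-! ## Favard spaces -/

/-- `|x|_{F_α} = sup_{t > 0} ‖t ^ (-α) • (T_t x - x)‖`, with values in `[0, ∞]`. -/
def favardNorm {𝕜 X : Type*} [RCLike 𝕜] [NormedAddCommGroup X] [NormedSpace 𝕜 X]
    (T : ℝ → X →L[𝕜] X) (α : ℝ) (x : X) : ℝ≥0∞ :=
  ⨆ (t : ℝ) (_ : 0 < t), ‖((1 / t ^ α : ℝ) : 𝕜) • (T t x - x)‖ₑ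

/-- The Favard space `F_α` of `T`. -/
def favardSpace {𝕜 X : Type*} [RCLike 𝕜] [NormedAddCommGroup X] [NormedSpace 𝕜 X]
    (T : ℝ → X →L[𝕜] X) (α : ℝ) : Set X :=
  {x | favardNorm T α x < ∞}

/-- The constant `ζ_α`. -/
def favardZeta (α : ℝ) : ℝ :=
  if α = 1 then 1
  else (2 * α / (1 - α)) ^ (1 - α) + 2 * (2 * α / (1 - α)) ^ (-α)

/-- The constant `g_α`. -/
def favardG (α : ℝ) : ℝ :=
  favardZeta α * (1 - α) ^ ((1 - α) / 2) * α ^ (α / 2)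

/-! ## Spectral measures and the Borel functional calculus -/

/-- A projection-valued measure on the Borel sets of `ℝ`: orthogonal projections `proj s`,
countably additive in the strong operator topology.  (Values of `proj` on non-Borel sets are
irrelevant.) -/
structure ProjectionValuedMeasure (𝓗 : Type*) [NormedAddCommGroup 𝓗] [InnerProductSpace ℂ 𝓗]
    [CompleteSpace 𝓗] where
  proj : Set ℝ → 𝓗 →L[ℂ] 𝓗
  isStarProjection : ∀ s, MeasurableSet s → IsStarProjection (proj s)
  empty : proj ∅ = 0
  univ : proj Set.univ = 1
  inter : ∀ s t, MeasurableSet s → MeasurableSet t → proj (s ∩ t) = proj s * proj t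
  hasSum_iUnion : ∀ f : ℕ → Set ℝ, (∀ i, MeasurableSet (f i)) →
    Pairwise (Function.onFun Disjoint f) → ∀ x : 𝓗, HasSum (fun i => proj (f i) x) (proj (⋃ i, f i) x)

namespace ProjectionValuedMeasure

variable {𝓗 : Type*} [NormedAddCommGroup 𝓗] [InnerProductSpace ℂ 𝓗] [CompleteSpace 𝓗]

open Classical in
/-- The projection-valued point mass at `0` (the spectral measure of the zero operator). -/
instance : Inhabited (ProjectionValuedMeasure 𝓗) where
  default :=
    { proj := fun s => if (0 : ℝ) ∈ s then 1 else 0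
      isStarProjection := by
        intro s _
        split_ifs
        · exact .one _
        · exact .zero _
      empty := by simp
      univ := by simp
      inter := by
        intro s t _ _
        by_cases hs : (0 : ℝ) ∈ s <;> by_cases ht : (0 : ℝ) ∈ t <;> simp [hs, ht]
      hasSum_iUnion := by
        intro f _ hd x
        by_cases h : (0 : ℝ) ∈ ⋃ i, f i
        · obtain ⟨i, hi⟩ := Set.mem_iUnion.1 h
          have : ∀ j, j ≠ i → (if (0 : ℝ) ∈ f j then (1 : 𝓗 →L[ℂ] 𝓗) else 0) x = 0 := by
            intro j hj
            rw [if_neg fun h0 => (Set.disjoint_left.1 (hd hj) h0 hi)]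
            rfl
          have h2 := hasSum_single (f := fun j => (if (0 : ℝ) ∈ f j then (1 : 𝓗 →L[ℂ] 𝓗) else 0) x)
            i this
          simpa only [if_pos hi, if_pos h] using h2
        · have : ∀ j, (0 : ℝ) ∉ f j := fun j hj => h (Set.mem_iUnion.2 ⟨j, hj⟩)
          simp [this] }

variable (E : ProjectionValuedMeasure 𝓗)

theorem inner_proj_proj {s t : Set ℝ} (hs : MeasurableSet s) (ht : MeasurableSet t) (x : 𝓗) :
    ⟪E.proj s x, E.proj t x⟫_ℂ = ⟪x, E.proj (s ∩ t) x⟫_ℂ := by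
  have h1 : (E.proj s).adjoint = E.proj s := (E.isStarProjection s hs).isSelfAdjoint
  have h2 := ContinuousLinearMap.adjoint_inner_left (E.proj s) (E.proj t x) x
  rw [h1] at h2
  rw [E.inter s t hs ht, h2]
  rfl

theorem re_inner_proj {s : Set ℝ} (hs : MeasurableSet s) (x : 𝓗) :
    (⟪x, E.proj s x⟫_ℂ).re = ‖E.proj s x‖ ^ 2 := by
  have h := E.inner_proj_proj hs hs x
  rw [Set.inter_self, inner_self_eq_norm_sq_to_K] at h
  rw [← h]
  norm_cast

/-- The scalar spectral measure `s ↦ ⟨E(s) x, x⟩`. -/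
def measure (x : 𝓗) : Measure ℝ :=
  Measure.ofMeasurable (fun s _ => ENNReal.ofReal (⟪x, E.proj s x⟫_ℂ).re)
    (by simp [E.empty])
    (by
      intro f hf hd
      have h : HasSum (fun i => (⟪x, E.proj (f i) x⟫_ℂ).re) (⟪x, E.proj (⋃ i, f i) x⟫_ℂ).re :=
        Complex.hasSum_re ((innerSL ℂ x).hasSum (E.hasSum_iUnion f hf hd x))
      rw [← h.tsum_eq]
      refine ENNReal.ofReal_tsum_of_nonneg (fun i => ?_) h.summable
      rw [E.re_inner_proj (hf i)]
      positivity)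

theorem measure_apply {s : Set ℝ} (hs : MeasurableSet s) (x : 𝓗) :
    E.measure x s = ENNReal.ofReal (⟪x, E.proj s x⟫_ℂ).re :=
  Measure.ofMeasurable_apply s hs

theorem measure_apply' {s : Set ℝ} (hs : MeasurableSet s) (x : 𝓗) :
    E.measure x s = ‖E.proj s x‖ₑ ^ 2 := by
  rw [E.measure_apply hs, E.re_inner_proj hs, ENNReal.ofReal_pow (norm_nonneg _),
    ofReal_norm]

instance (x : 𝓗) : IsFiniteMeasure (E.measure x) :=
  ⟨by rw [E.measure_apply MeasurableSet.univ]; exact ENNReal.ofReal_lt_top⟩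

/-- The integral `∑ c • E(φ = c)` of a simple function. -/
def simpleIntegral (φ : SimpleFunc ℝ ℂ) : 𝓗 →L[ℂ] 𝓗 :=
  ∑ c ∈ φ.range, c • E.proj (φ ⁻¹' {c})

theorem simpleIntegral_sub (φ ψ : SimpleFunc ℝ ℂ) :
    E.simpleIntegral (φ - ψ) = E.simpleIntegral φ - E.simpleIntegral ψ := by
  let S : Set ℝ → ℂ →L[ℝ] (𝓗 →L[ℂ] 𝓗) := fun s =>
    ((ContinuousLinearMap.id ℂ ℂ).smulRight (E.proj s)).restrictScalars ℝ
  have key : ∀ θ : SimpleFunc ℝ ℂ, E.simpleIntegral θ = θ.setToSimpleFunc S := fun θ => rfl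
  have hadd : FinMeasAdditive (0 : Measure ℝ) S := by
    intro s t hs ht _ _ hd
    have h : E.proj (s ∪ t) = E.proj s + E.proj t := by
      ext x
      have hu := E.hasSum_iUnion (fun n => if n = 0 then s else if n = 1 then t else ∅)
        (by intro i; split_ifs <;> simp [hs, ht])
        (by
          intro i j hij
          dsimp only [Function.onFun]
          split_ifs <;> first | omega | simp | simp [hd] | simp [hd.symm]) x
      have h2 : HasSum (fun n : ℕ => E.proj (if n = 0 then s else if n = 1 then t else ∅) x) _ :=
        hasSum_sum_of_ne_finset_zero (s := Finset.range 2) (by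
          intro b hb
          simp only [Finset.mem_range, not_lt] at hb
          rw [if_neg (by omega), if_neg (by omega), E.empty]
          rfl)
      have h3 : (⋃ n : ℕ, if n = 0 then s else if n = 1 then t else ∅) = s ∪ t := by
        ext y
        simp only [Set.mem_iUnion, Set.mem_union]
        constructor
        · rintro ⟨n, hn⟩
          split_ifs at hn
          · exact Or.inl hn
          · exact Or.inr hn
          · exact hn.elim
        · rintro (h | h)
          · exact ⟨0, by simpa using h⟩
          · exact ⟨1, by simpa using h⟩
      rw [h3] at hu
      have h4 := hu.unique h2
      simpa [Finset.sum_range_succ] using h4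
    ext c x
    simp [S, h]
  simp only [key]
  refine SimpleFunc.setToSimpleFunc_sub S hadd ?_ ?_ <;> exact integrable_zero_measure

theorem enorm_simpleIntegral (φ : SimpleFunc ℝ ℂ) (x : 𝓗) :
    ‖E.simpleIntegral φ x‖ₑ = eLpNorm φ 2 (E.measure x) := by
  have hm : ∀ c, MeasurableSet (φ ⁻¹' {c}) := fun c => φ.measurableSet_fiber c
  have h1 : ‖E.simpleIntegral φ x‖ ^ 2 =
      ∑ c ∈ φ.range, ‖c‖ ^ 2 * ‖E.proj (φ ⁻¹' {c}) x‖ ^ 2 := by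
    have : ((‖E.simpleIntegral φ x‖ ^ 2 : ℝ) : ℂ) =
        ((∑ c ∈ φ.range, ‖c‖ ^ 2 * ‖E.proj (φ ⁻¹' {c}) x‖ ^ 2 : ℝ) : ℂ) := by
      push_cast
      have h0 := inner_self_eq_norm_sq_to_K (𝕜 := ℂ) (E.simpleIntegral φ x)
      refine h0.symm.trans ?_
      rw [simpleIntegral, sum_apply, sum_inner]
      refine Finset.sum_congr rfl fun c hc => ?_
      rw [inner_sum, Finset.sum_eq_single_of_mem c hc]
      · rw [smul_apply, inner_smul_left, inner_smul_right,
          inner_self_eq_norm_sq_to_K, ← mul_assoc, ← Complex.conj_mul']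
        rfl
      · intro d _ hd
        rw [smul_apply, smul_apply, inner_smul_left,
          inner_smul_right, E.inner_proj_proj (hm c) (hm d)]
        have : (φ ⁻¹' {c}) ∩ (φ ⁻¹' {d}) = ∅ := by
          ext y
          simp only [Set.mem_inter_iff, Set.mem_preimage, Set.mem_singleton_iff,
            Set.mem_empty_iff_false, iff_false, not_and]
          intro h1 h2
          exact hd (h2.symm.trans h1)
        rw [this, E.empty]
        simp
    exact_mod_cast this
  have h2 : ‖E.simpleIntegral φ x‖ₑ ^ 2 = ∫⁻ s, ‖φ s‖ₑ ^ 2 ∂(E.measure x) := by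
    have h3 : ∫⁻ s, ‖φ s‖ₑ ^ 2 ∂(E.measure x) =
        ∑ c ∈ φ.range, ‖c‖ₑ ^ 2 * E.measure x (φ ⁻¹' {c}) := by
      rw [← SimpleFunc.map_lintegral (fun c : ℂ => ‖c‖ₑ ^ 2) φ,
        ← SimpleFunc.lintegral_eq_lintegral]
      rfl
    rw [h3, ← ofReal_norm, ← ENNReal.ofReal_pow (norm_nonneg _), h1,
      ENNReal.ofReal_sum_of_nonneg (fun _ _ => by positivity)]
    refine Finset.sum_congr rfl fun c _ => ?_
    rw [E.measure_apply' (hm c), ENNReal.ofReal_mul (by positivity),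
      ENNReal.ofReal_pow (norm_nonneg _), ENNReal.ofReal_pow (norm_nonneg _),
      ofReal_norm, ofReal_norm]
  have h4 : eLpNorm φ 2 (E.measure x) ^ 2 = ∫⁻ s, ‖φ s‖ₑ ^ 2 ∂(E.measure x) := by
    have := eLpNorm_nnreal_pow_eq_lintegral (μ := E.measure x) (f := φ) (p := 2) (by norm_num)
    simpa using this
  exact (ENNReal.pow_right_strictMono two_ne_zero).injective (h2.trans h4.symm)

theorem measure_add_le (x y : 𝓗) :
    E.measure (x + y) ≤ (2 : ℝ≥0∞) • E.measure x + (2 : ℝ≥0∞) • E.measure y := by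
  refine Measure.le_iff.2 fun s hs => ?_
  simp only [Measure.add_apply, Measure.smul_apply, smul_eq_mul]
  rw [E.measure_apply' hs, E.measure_apply' hs, E.measure_apply' hs, map_add]
  simp only [← ofReal_norm]
  have h2 : (2 : ℝ≥0∞) = ENNReal.ofReal 2 := by simp
  rw [h2, ← ENNReal.ofReal_pow (norm_nonneg _), ← ENNReal.ofReal_pow (norm_nonneg _),
    ← ENNReal.ofReal_pow (norm_nonneg _), ← ENNReal.ofReal_mul (by norm_num),
    ← ENNReal.ofReal_mul (by norm_num), ← ENNReal.ofReal_add (by positivity) (by positivity)]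
  refine ENNReal.ofReal_le_ofReal ?_
  have h := norm_add_le (E.proj s x) (E.proj s y)
  nlinarith [norm_nonneg (E.proj s x + E.proj s y), norm_nonneg (E.proj s x),
    norm_nonneg (E.proj s y), sq_nonneg (‖E.proj s x‖ - ‖E.proj s y‖)]

theorem measure_smul (c : ℂ) (x : 𝓗) : E.measure (c • x) = (‖c‖ₑ ^ 2) • E.measure x := by
  refine Measure.ext fun s hs => ?_
  rw [Measure.smul_apply, E.measure_apply' hs, E.measure_apply' hs, map_smul, enorm_smul, mul_pow,
    smul_eq_mul]

theorem measure_zero : E.measure 0 = 0 := by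
  refine Measure.ext fun s hs => ?_
  rw [E.measure_apply' hs]
  simp

/-- The domain `{x | ∫ |f|² d⟨E x, x⟩ < ∞}` of `∫ f dE`. -/
def integralDomain (f : ℝ → ℂ) : Submodule ℂ 𝓗 where
  carrier := {x | ∫⁻ s, ‖f s‖ₑ ^ 2 ∂(E.measure x) < ∞}
  zero_mem' := by simp [E.measure_zero]
  add_mem' := by
    intro x y hx hy
    refine (lintegral_mono' (E.measure_add_le x y) le_rfl).trans_lt ?_
    rw [lintegral_add_measure, lintegral_smul_measure, lintegral_smul_measure]
    exact ENNReal.add_lt_top.2 ⟨ENNReal.mul_lt_top (by simp) hx, ENNReal.mul_lt_top (by simp) hy⟩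
  smul_mem' := by
    intro c x hx
    change ∫⁻ s, ‖f s‖ₑ ^ 2 ∂(E.measure (c • x)) < ∞
    rw [E.measure_smul, lintegral_smul_measure]
    exact ENNReal.mul_lt_top (ENNReal.pow_lt_top enorm_lt_top) hx

/-- A sequence of simple functions converging pointwise to `f` with `‖φ_n‖ ≤ 2 ‖f‖`. -/
def simpleApprox (f : ℝ → ℂ) (hf : Measurable f) (n : ℕ) : SimpleFunc ℝ ℂ :=
  SimpleFunc.approxOn f hf Set.univ 0 (Set.mem_univ 0) n

theorem eLpNorm_sq (f : ℝ → ℂ) (μ : Measure ℝ) :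
    eLpNorm f 2 μ ^ 2 = ∫⁻ s, ‖f s‖ₑ ^ 2 ∂μ := by
  have := eLpNorm_nnreal_pow_eq_lintegral (μ := μ) (f := f) (p := 2) (by norm_num)
  simpa using this

theorem exists_tendsto_simpleIntegral (f : ℝ → ℂ) (hf : Measurable f) (x : 𝓗)
    (hx : x ∈ E.integralDomain f) :
    ∃ y, Tendsto (fun n => E.simpleIntegral (simpleApprox f hf n) x) atTop (𝓝 y) := by
  refine cauchySeq_tendsto_of_complete ?_
  have hfin : eLpNorm f 2 (E.measure x) < ∞ := by
    have h : eLpNorm f 2 (E.measure x) ^ 2 < ∞ := by rw [eLpNorm_sq]; exact hx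
    exact (ENNReal.pow_lt_top_iff.1 h).resolve_right two_ne_zero
  have hlim : Tendsto (fun n => eLpNorm (⇑(simpleApprox f hf n) - f) 2 (E.measure x)) atTop (𝓝 0) :=
    SimpleFunc.tendsto_approxOn_Lp_eLpNorm hf (Set.mem_univ 0) (by simp) (by simp) (by simpa using hfin)
  refine EMetric.cauchySeq_iff.2 fun ε hε => ?_
  obtain ⟨δ, hδ0, hδ⟩ : ∃ δ : ℝ≥0∞, 0 < δ ∧ δ + δ < ε := by
    obtain ⟨η, hη0, hη⟩ := exists_between hε
    exact ⟨η / 2, ENNReal.div_pos hη0.ne' (by simp), by rwa [ENNReal.add_halves]⟩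
  obtain ⟨N, hN⟩ := (((ENNReal.tendsto_nhds_zero.1 hlim) δ hδ0)).exists_forall_of_atTop
  refine ⟨N, fun m hm n hn => ?_⟩
  rw [edist_eq_enorm_sub, ← sub_apply, ← E.simpleIntegral_sub, E.enorm_simpleIntegral]
  have h1 : ⇑(simpleApprox f hf m - simpleApprox f hf n) =
      (⇑(simpleApprox f hf m) - f) - (⇑(simpleApprox f hf n) - f) := by
    rw [SimpleFunc.coe_sub]
    abel
  have hms : ∀ k, AEStronglyMeasurable (⇑(simpleApprox f hf k) - f) (E.measure x) := fun k =>
    ((simpleApprox f hf k).measurable.sub hf).aestronglyMeasurable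
  rw [h1]
  calc eLpNorm ((⇑(simpleApprox f hf m) - f) - (⇑(simpleApprox f hf n) - f)) 2 (E.measure x)
      ≤ eLpNorm (⇑(simpleApprox f hf m) - f) 2 (E.measure x) +
          eLpNorm (⇑(simpleApprox f hf n) - f) 2 (E.measure x) :=
        eLpNorm_sub_le (hms m) (hms n) (by norm_num)
    _ ≤ δ + δ := add_le_add (hN m hm) (hN n hn)
    _ < ε := hδ

/-- The (possibly unbounded) operator `∫ f dE`: on its natural domain it is the limit of the
integrals of simple functions `φ_n → f`. -/
def integral (f : ℝ → ℂ) (hf : Measurable f) : 𝓗 →ₗ.[ℂ] 𝓗 where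
  domain := E.integralDomain f
  toFun :=
    { toFun := fun x => limUnder atTop fun n => E.simpleIntegral (simpleApprox f hf n) (x : 𝓗)
      map_add' := by
        intro a b
        have ha := tendsto_nhds_limUnder (E.exists_tendsto_simpleIntegral f hf a a.2)
        have hb := tendsto_nhds_limUnder (E.exists_tendsto_simpleIntegral f hf b b.2)
        refine ((ha.add hb).congr fun n => ?_).limUnder_eq
        rw [Submodule.coe_add, map_add]
      map_smul' := by
        intro c a
        have ha := tendsto_nhds_limUnder (E.exists_tendsto_simpleIntegral f hf a a.2)
        refine ((ha.const_smul c).congr fun n => ?_).limUnder_eq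
        rw [Submodule.coe_smul, map_smul] }

theorem mem_integralDomain_of_bounded {f : ℝ → ℂ} (hb : ∀ s, ‖f s‖ ≤ 1) (x : 𝓗) :
    x ∈ E.integralDomain f := by
  change ∫⁻ s, ‖f s‖ₑ ^ 2 ∂(E.measure x) < ∞
  refine (lintegral_mono (g := fun _ => 1) fun s => ?_).trans_lt ?_
  · rw [← ofReal_norm]
    exact pow_le_one₀ (by simp) (ENNReal.ofReal_le_one.2 (hb s))
  · simp

theorem norm_integral_le {f : ℝ → ℂ} (hf : Measurable f) (hb : ∀ s, ‖f s‖ ≤ 1)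
    (x : (E.integral f hf).domain) : ‖E.integral f hf x‖ ≤ 2 * ‖(x : 𝓗)‖ := by
  have hlim := tendsto_nhds_limUnder (E.exists_tendsto_simpleIntegral f hf x x.2)
  refine le_of_tendsto hlim.norm (Eventually.of_forall fun n => ?_)
  have h1 : ‖E.simpleIntegral (simpleApprox f hf n) (x : 𝓗)‖ₑ ^ 2 ≤ (2 * ‖(x : 𝓗)‖ₑ) ^ 2 := by
    rw [E.enorm_simpleIntegral, eLpNorm_sq]
    refine (lintegral_mono (g := fun _ => 2 ^ 2) fun s => ?_).trans ?_
    · refine pow_le_pow_left₀ (by simp) ?_ 2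
      have h2 : ‖simpleApprox f hf n s‖ ≤ ‖f s‖ + ‖f s‖ :=
        SimpleFunc.norm_approxOn_zero_le hf (Set.mem_univ 0) s n
      rw [← ofReal_norm]
      refine (ENNReal.ofReal_le_ofReal (h2.trans (add_le_add (hb s) (hb s)))).trans ?_
      norm_num
    · rw [lintegral_const, E.measure_apply' MeasurableSet.univ, E.univ, mul_pow]
      exact le_rfl
  have h3 := (ENNReal.pow_right_strictMono two_ne_zero).le_iff_le.1 h1
  have h4 : (2 : ℝ≥0∞) * ‖(x : 𝓗)‖ₑ = ENNReal.ofReal (2 * ‖(x : 𝓗)‖) := by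
    rw [ENNReal.ofReal_mul (by norm_num), ofReal_norm]
    simp
  rw [h4, ← ofReal_norm] at h3
  exact (ENNReal.ofReal_le_ofReal_iff (by positivity)).1 h3

/-- The integral of a measurable function bounded by `1`, as a bounded operator on `𝓗`. -/
def boundedIntegral (f : ℝ → ℂ) (hf : Measurable f) (hb : ∀ s, ‖f s‖ ≤ 1) : 𝓗 →L[ℂ] 𝓗 :=
  LinearMap.mkContinuous
    ((E.integral f hf).toFun.comp
      (LinearMap.id.codRestrict (E.integral f hf).domain (E.mem_integralDomain_of_bounded hb)))
    2 (fun _ => E.norm_integral_le hf hb _)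

end ProjectionValuedMeasure

section SpectralMeasure

variable {𝓗 : Type*} [NormedAddCommGroup 𝓗] [InnerProductSpace ℂ 𝓗] [CompleteSpace 𝓗]

/-- `E` is the spectral measure of `H`: `H = ∫ s dE(s)`, including equality of domains. -/
def IsSpectralMeasure (H : 𝓗 →ₗ.[ℂ] 𝓗) (E : ProjectionValuedMeasure 𝓗) : Prop :=
  E.integral (fun s : ℝ => (s : ℂ)) Complex.measurable_ofReal = H

/-- The spectral measure of `H`, i.e. the projection-valued measure `E` with `H = ∫ s dE(s)`.
By the spectral theorem it exists and is unique (on Borel sets) for every self-adjoint `H`. -/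
def spectralMeasure (H : 𝓗 →ₗ.[ℂ] 𝓗) : ProjectionValuedMeasure 𝓗 :=
  Classical.epsilon (IsSpectralMeasure H)

/-- `|H| ^ α`, by the Borel functional calculus of `H`. -/
def absPow (H : 𝓗 →ₗ.[ℂ] 𝓗) (α : ℝ) : 𝓗 →ₗ.[ℂ] 𝓗 :=
  (spectralMeasure H).integral (fun s : ℝ => ((|s| ^ α : ℝ) : ℂ))
    (Complex.measurable_ofReal.comp (measurable_norm.pow_const α))

/-- The one-parameter group `t ↦ e^{-itH}`, by the Borel functional calculus of `H`. -/
def schrodingerGroup (H : 𝓗 →ₗ.[ℂ] 𝓗) (t : ℝ) : 𝓗 →L[ℂ] 𝓗 :=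
  (spectralMeasure H).boundedIntegral (fun s : ℝ => Complex.exp (-Complex.I * t * s))
    (by fun_prop) (by intro s; simp [Complex.norm_exp])

end SpectralMeasure

end

/-!
Semigroup part.  For a contraction semigroup `T` with generator `A` and `l > 0`, the Laplace
transform `R x = ∫₀^∞ e^{-lt} T_t x dt` is a two-sided inverse of `l - A`
(`IsContractionSemigroup.isResolventAt_laplace`): `T_s R x` is computed by a shift of the range of
integration, and its right derivative at `s = 0` is `A R x = l R x - x`.  Two estimates follow.

* If `‖T_t x - x‖ ≤ M t^α`, then `A R x = l ∫₀^∞ e^{-lt} (T_t x - x) dt` has norm at most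
  `M Γ(α + 1) l^{-α}`.
* Conversely, in `x = l R x - A R x` the first summand lies in the domain of `A`, where orbits are
  Lipschitz (`IsContractionSemigroup.norm_apply_sub_self_le`), so that
  `‖T_t x - x‖ ≤ (l t + 2) ‖A R x‖`.  With `l = c / t` and `‖A R x‖ ≤ K l^{-α}` the right-hand side is
  `(c^{1-α} + 2 c^{-α}) K t^α`, and `ζ_α` is the infimum of the first factor over `c > 0`.

Self-adjoint part.  By the isometry property of the spectral integral
(`ProjectionValuedMeasure.enorm_integral_sub_simpleIntegral`) the squared norms of `e^{-itH} x - x`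
and `|H|^α x` are the integrals of `|e^{-its} - 1|²` and `|s|^{2α}` with respect to the scalar
spectral measure of `x`.  The bound therefore reduces to
`|e^{-iθ} - 1| ≤ min (2, |θ|) ≤ 2^{1-α} |θ|^α`, together with
`2^{1-α} ≤ 2^{1-α} (1-α)^{-(1-α)/2} α^{-α/2} = g_α` for `α < 1` and the equality `g_1 = 1`.
-/

open MeasureTheory Filter Topology
open scoped ENNReal InnerProductSpace

/-! ### The generator and orbits of a contraction semigroup -/

section ContractionSemigroup

variable {𝕜 X : Type*} [RCLike 𝕜] [NormedAddCommGroup X] [NormedSpace 𝕜 X]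
  {T : ℝ → X →L[𝕜] X}

/-- The value of the generator is the limit that defines its domain. -/
theorem tendsto_semigroupGenerator (x : (semigroupGenerator T).domain) :
    Tendsto (fun t : ℝ => ((t : 𝕜)⁻¹) • (T t (x : X) - x)) (𝓝[>] 0)
      (𝓝 (semigroupGenerator T x)) :=
  Classical.choose_spec x.2

theorem semigroupGenerator_eq_of_tendsto {x y : X}
    (h : Tendsto (fun t : ℝ => ((t : 𝕜)⁻¹) • (T t x - x)) (𝓝[>] 0) (𝓝 y)) :
    ∃ hx : x ∈ (semigroupGenerator T).domain, semigroupGenerator T ⟨x, hx⟩ = y :=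
  ⟨⟨y, h⟩, tendsto_nhds_unique (tendsto_semigroupGenerator ⟨x, ⟨y, h⟩⟩) h⟩

namespace IsContractionSemigroup

theorem norm_apply_sub_le (hT : IsContractionSemigroup T) {s t : ℝ} (hs : 0 ≤ s) (ht : 0 ≤ t)
    (x : X) : ‖T t x - T s x‖ ≤ ‖T |t - s| x - x‖ := by
  wlog h : s ≤ t generalizing s t
  · rw [norm_sub_rev, abs_sub_comm]
    exact this ht hs (le_of_not_ge h)
  have h1 : T t x = T s (T (t - s) x) := by
    rw [← mul_apply_eq_comp, ← hT.map_add s (t - s) hs (by linarith)]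
    simp
  rw [abs_of_nonneg (by linarith), h1, ← map_sub]
  exact hT.contraction s hs _

theorem continuousOn (hT : IsContractionSemigroup T) (x : X) :
    ContinuousOn (fun t => T t x) (Set.Ici 0) := by
  intro s hs
  have h0 : ContinuousWithinAt (fun t => T t x) (Set.Ici 0) 0 := by
    rw [← continuousWithinAt_Ioi_iff_Ici]
    simpa [ContinuousWithinAt, hT.map_zero] using hT.strongly_continuous x
  have h1 : Tendsto (fun t => |t - s|) (𝓝[Set.Ici 0] s) (𝓝[Set.Ici 0] 0) := by
    refine tendsto_nhdsWithin_iff.2 ⟨?_, Eventually.of_forall fun t => Set.mem_Ici.2 (abs_nonneg _)⟩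
    have : Continuous fun t : ℝ => |t - s| := by fun_prop
    simpa using (this.tendsto s).mono_left nhdsWithin_le_nhds
  have h2 : Tendsto (fun t => ‖T |t - s| x - x‖) (𝓝[Set.Ici 0] s) (𝓝 0) := by
    have := ((h0.tendsto.comp h1).sub_const x).norm
    simpa [hT.map_zero] using this
  rw [ContinuousWithinAt, tendsto_iff_norm_sub_tendsto_zero]
  refine squeeze_zero' (Eventually.of_forall fun _ => norm_nonneg _) ?_ h2
  filter_upwards [self_mem_nhdsWithin] with t ht
  exact hT.norm_apply_sub_le hs ht x

variable [NormedSpace ℝ X] [IsScalarTower ℝ 𝕜 X]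

/-- The difference quotients in the definition of the generator are those of the right derivative
at `0` of the orbit, with respect to the real structure. -/
theorem tendsto_iff_hasDerivWithinAt (hT : IsContractionSemigroup T) {x y : X} :
    Tendsto (fun t : ℝ => ((t : 𝕜)⁻¹) • (T t x - x)) (𝓝[>] 0) (𝓝 y) ↔
      HasDerivWithinAt (fun t => T t x) y (Set.Ici 0) 0 := by
  rw [← hasDerivWithinAt_Ioi_iff_Ici, hasDerivWithinAt_iff_tendsto_slope' (by simp)]
  refine tendsto_congr fun t => ?_
  rw [slope_def_module, hT.map_zero, sub_zero, RCLike.real_smul_eq_coe_smul (K := 𝕜)]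
  simp

theorem hasDerivWithinAt_apply (hT : IsContractionSemigroup T)
    (x : (semigroupGenerator T).domain) {t : ℝ} (ht : 0 ≤ t) :
    HasDerivWithinAt (fun s => T s (x : X)) (T t (semigroupGenerator T x)) (Set.Ici t) t := by
  have h0 : HasDerivWithinAt (fun s => T s (x : X)) (semigroupGenerator T x) (Set.Ici 0) (t - t) := by
    rw [sub_self]
    exact hT.tendsto_iff_hasDerivWithinAt.1 (tendsto_semigroupGenerator x)
  have h1 : HasDerivWithinAt (fun s => s - t) 1 (Set.Ici t) t :=
    (hasDerivWithinAt_id t _).sub_const t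
  have h2 := HasDerivWithinAt.scomp (h := fun s => s - t) t h0 h1
    fun s hs => Set.mem_Ici.2 (sub_nonneg.2 hs)
  rw [one_smul] at h2
  have h3 := ((T t).restrictScalars ℝ).hasFDerivAt.comp_hasDerivWithinAt t h2
  refine h3.congr_of_mem (fun s hs => ?_) Set.self_mem_Ici
  change T s (x : X) = (T t * T (s - t)) (x : X)
  rw [← hT.map_add t (s - t) ht (sub_nonneg.2 hs), add_sub_cancel]

/-- On the domain of the generator, orbits are Lipschitz with constant `‖A x‖`. -/
theorem norm_apply_sub_self_le (hT : IsContractionSemigroup T)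
    (x : (semigroupGenerator T).domain) {t : ℝ} (ht : 0 ≤ t) :
    ‖T t (x : X) - x‖ ≤ t * ‖semigroupGenerator T x‖ := by
  have h := norm_image_sub_le_of_norm_deriv_right_le_segment
    ((hT.continuousOn (x : X)).mono Set.Icc_subset_Ici_self)
    (fun s hs => hT.hasDerivWithinAt_apply x hs.1)
    (fun s hs => hT.contraction s hs.1 _) t (Set.right_mem_Icc.2 ht)
  simpa [hT.map_zero, mul_comm] using h

end IsContractionSemigroup

/-! ### The resolvent as a Laplace transform -/

theorem integrableOn_rpow_mul_exp_neg_mul {a l : ℝ} (ha : 0 < a) (hl : 0 < l) :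
    IntegrableOn (fun t : ℝ => t ^ (a - 1) * Real.exp (-(l * t))) (Set.Ioi 0) := by
  refine Integrable.of_integral_ne_zero ?_
  rw [Real.integral_rpow_mul_exp_neg_mul_Ioi ha hl]
  have := Real.Gamma_pos_of_pos ha
  positivity

theorem integrableOn_exp_neg_mul {l : ℝ} (hl : 0 < l) :
    IntegrableOn (fun t : ℝ => Real.exp (-(l * t))) (Set.Ioi 0) := by
  simpa using integrableOn_rpow_mul_exp_neg_mul one_pos hl

theorem integral_exp_neg_mul {l : ℝ} (hl : 0 < l) :
    ∫ t in Set.Ioi (0 : ℝ), Real.exp (-(l * t)) = l⁻¹ := by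
  simpa using Real.integral_rpow_mul_exp_neg_mul_Ioi one_pos hl

namespace IsContractionSemigroup

variable [NormedSpace ℝ X]

theorem continuousOn_exp_smul (hT : IsContractionSemigroup T) (l : ℝ) (x : X) :
    ContinuousOn (fun t => Real.exp (-(l * t)) • T t x) (Set.Ici 0) :=
  (by fun_prop : Continuous fun t : ℝ => Real.exp (-(l * t))).continuousOn.smul (hT.continuousOn x)

theorem integrableOn_exp_smul (hT : IsContractionSemigroup T) {l : ℝ} (hl : 0 < l) (x : X) :
    IntegrableOn (fun t => Real.exp (-(l * t)) • T t x) (Set.Ioi 0) := by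
  refine Integrable.mono' ((integrableOn_exp_neg_mul hl).mul_const ‖x‖)
    (((hT.continuousOn_exp_smul l x).mono Set.Ioi_subset_Ici_self).aestronglyMeasurable
      measurableSet_Ioi) ?_
  filter_upwards [ae_restrict_mem measurableSet_Ioi] with t ht
  rw [norm_smul, Real.norm_eq_abs, Real.abs_exp]
  gcongr
  exact hT.contraction t (le_of_lt ht) x

variable [IsScalarTower ℝ 𝕜 X]

/-- The Laplace transform `x ↦ ∫₀^∞ e^{-lt} T_t x dt` of a contraction semigroup. -/
noncomputable def laplace (hT : IsContractionSemigroup T) {l : ℝ} (hl : 0 < l) : X →L[𝕜] X :=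
  LinearMap.mkContinuous
    { toFun := fun x => ∫ t in Set.Ioi (0 : ℝ), Real.exp (-(l * t)) • T t x
      map_add' := fun x y => by
        rw [← integral_add (hT.integrableOn_exp_smul hl x) (hT.integrableOn_exp_smul hl y)]
        simp
      map_smul' := fun c x => by
        rw [RingHom.id_apply, ← integral_smul]
        refine integral_congr_ae (Eventually.of_forall fun t => ?_)
        dsimp only
        rw [map_smul, RCLike.real_smul_eq_coe_smul (K := 𝕜), RCLike.real_smul_eq_coe_smul (K := 𝕜),
          smul_comm] }
    l⁻¹ fun x => by
      rw [← integral_exp_neg_mul hl, ← integral_mul_const]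
      refine norm_integral_le_of_norm_le ((integrableOn_exp_neg_mul hl).mul_const ‖x‖) ?_
      filter_upwards [ae_restrict_mem measurableSet_Ioi] with t ht
      rw [norm_smul, Real.norm_eq_abs, Real.abs_exp]
      gcongr
      exact hT.contraction t (le_of_lt ht) x

theorem laplace_apply (hT : IsContractionSemigroup T) {l : ℝ} (hl : 0 < l) (x : X) :
    hT.laplace hl x = ∫ t in Set.Ioi (0 : ℝ), Real.exp (-(l * t)) • T t x :=
  rfl

variable [CompleteSpace X]

theorem apply_laplace (hT : IsContractionSemigroup T) {l : ℝ} (hl : 0 < l) (s : ℝ) (x : X) :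
    T s (hT.laplace hl x) = ∫ t in Set.Ioi (0 : ℝ), Real.exp (-(l * t)) • T s (T t x) := by
  rw [laplace_apply, ← ContinuousLinearMap.integral_comp_comm _ (hT.integrableOn_exp_smul hl x)]
  simp_rw [RCLike.real_smul_eq_coe_smul (K := 𝕜), map_smul]

theorem laplace_comm (hT : IsContractionSemigroup T) {l : ℝ} (hl : 0 < l) {s : ℝ} (hs : 0 ≤ s)
    (x : X) : T s (hT.laplace hl x) = hT.laplace hl (T s x) := by
  rw [hT.apply_laplace, hT.laplace_apply]
  refine setIntegral_congr_fun measurableSet_Ioi fun t ht => ?_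
  have ht' : 0 ≤ t := le_of_lt ht
  rw [← mul_apply_eq_comp, ← mul_apply_eq_comp, ← hT.map_add s t hs ht',
    ← hT.map_add t s ht' hs, add_comm]

/-- Substituting `t ↦ t - s` in the Laplace transform moves `T_s` into the range of
integration. -/
theorem apply_laplace_eq (hT : IsContractionSemigroup T) {l : ℝ} (hl : 0 < l) {s : ℝ} (hs : 0 ≤ s)
    (x : X) : T s (hT.laplace hl x) =
      Real.exp (l * s) • (hT.laplace hl x - ∫ t in (0 : ℝ)..s, Real.exp (-(l * t)) • T t x) := by
  have hi := hT.integrableOn_exp_smul hl x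
  have h1 : hT.laplace hl x - ∫ t in (0 : ℝ)..s, Real.exp (-(l * t)) • T t x =
      ∫ t in Set.Ioi s, Real.exp (-(l * t)) • T t x := by
    rw [laplace_apply, ← intervalIntegral.integral_interval_add_Ioi hi
      (hi.mono_set (Set.Ioi_subset_Ioi hs)), add_sub_cancel_left]
  have h2 := (measurePreserving_add_right volume s).setIntegral_preimage_emb
    (MeasurableEquiv.addRight s).measurableEmbedding
    (fun t => Real.exp (-(l * t)) • T t x) (Set.Ioi s)
  have h3 : (fun t => t + s) ⁻¹' Set.Ioi s = Set.Ioi 0 := by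
    ext t
    simp
  rw [h3] at h2
  rw [h1, ← h2, ← integral_smul, hT.apply_laplace]
  refine setIntegral_congr_fun measurableSet_Ioi fun t ht => ?_
  have ht' : 0 ≤ t := le_of_lt ht
  rw [smul_smul, ← Real.exp_add, ← mul_apply_eq_comp, ← hT.map_add s t hs ht',
    add_comm s t]
  congr 2
  ring

/-- The Laplace transform maps into the domain of the generator `A`, and `A R x = l R x - x`. -/
theorem tendsto_laplace (hT : IsContractionSemigroup T) {l : ℝ} (hl : 0 < l) (x : X) :
    Tendsto (fun t : ℝ => ((t : 𝕜)⁻¹) • (T t (hT.laplace hl x) - hT.laplace hl x)) (𝓝[>] 0)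
      (𝓝 (l • hT.laplace hl x - x)) := by
  rw [hT.tendsto_iff_hasDerivWithinAt]
  have h1 : HasDerivWithinAt (fun s : ℝ => Real.exp (l * s)) l (Set.Ici 0) 0 := by
    have h := ((hasDerivAt_id (0 : ℝ)).const_mul l).exp
    simpa using h.hasDerivWithinAt
  have h2 : HasDerivWithinAt (fun s => ∫ t in (0 : ℝ)..s, Real.exp (-(l * t)) • T t x)
      (Real.exp (-(l * 0)) • T 0 x) (Set.Ici 0) 0 :=
    intervalIntegral.integral_hasDerivWithinAt_right (t := Set.Ioi 0) (by simp)
      (((hT.continuousOn_exp_smul l x).mono Set.Ioi_subset_Ici_self).stronglyMeasurableAtFilter_nhdsWithin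
        measurableSet_Ioi 0)
      (((hT.continuousOn_exp_smul l x) 0 Set.self_mem_Ici).mono Set.Ioi_subset_Ici_self)
  have h3 := h1.smul (h2.const_sub (hT.laplace hl x))
  refine (h3.congr_deriv ?_).congr_of_mem (fun s hs => hT.apply_laplace_eq hl hs x) Set.self_mem_Ici
  simp [hT.map_zero]
  abel

theorem isResolventAt_laplace (hT : IsContractionSemigroup T) {l : ℝ} (hl : 0 < l) :
    IsResolventAt (semigroupGenerator T) (l : 𝕜) (hT.laplace hl) := by
  refine ⟨fun y => ?_, fun x => ?_⟩
  · obtain ⟨h, he⟩ := semigroupGenerator_eq_of_tendsto (hT.tendsto_laplace hl y)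
    refine ⟨h, ?_⟩
    rw [he, ← RCLike.real_smul_eq_coe_smul (K := 𝕜)]
    abel
  · -- `R` commutes with the difference quotients, hence `R A x = A R x = l R x - x`.
    have h1 := ((hT.laplace hl).continuous.tendsto _).comp (tendsto_semigroupGenerator x)
    have h2 : hT.laplace hl (semigroupGenerator T x) = l • hT.laplace hl x - (x : X) := by
      refine tendsto_nhds_unique h1 ((hT.tendsto_laplace hl (x : X)).congr' ?_)
      filter_upwards [self_mem_nhdsWithin] with t ht
      rw [Function.comp_apply, map_smul, map_sub, hT.laplace_comm hl (le_of_lt ht)]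
    rw [map_sub, h2, map_smul, ← RCLike.real_smul_eq_coe_smul (K := 𝕜)]
    abel

theorem unboundedResolvent_eq_laplace (hT : IsContractionSemigroup T) {l : ℝ} (hl : 0 < l) :
    unboundedResolvent (semigroupGenerator T) (l : 𝕜) = hT.laplace hl := by
  have h := isResolventAt_unboundedResolvent
    (A := semigroupGenerator T) (z := (l : 𝕜)) ⟨_, hT.isResolventAt_laplace hl⟩
  ext y
  obtain ⟨hy, he⟩ := (hT.isResolventAt_laplace hl).1 y
  have h2 := h.2 ⟨_, hy⟩
  rwa [he] at h2

/-- `A R = l R - 1` for the resolvent `R = (l - A)⁻¹`. -/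
theorem semigroupGenerator_unboundedResolvent (hT : IsContractionSemigroup T) {l : ℝ} (hl : 0 < l)
    (x : X) :
    semigroupGenerator T ⟨unboundedResolvent (semigroupGenerator T) (l : 𝕜) x,
      unboundedResolvent_mem_domain _ _ x⟩ = l • hT.laplace hl x - x := by
  obtain ⟨h, he⟩ := semigroupGenerator_eq_of_tendsto (hT.tendsto_laplace hl x)
  rw [← he]
  congr 2
  rw [hT.unboundedResolvent_eq_laplace hl]

end IsContractionSemigroup

end ContractionSemigroup

/-! ### The constants -/

/-- The choice `c = 2α/(1-α)` minimizes `c^{1-α} + 2c^{-α}`, with minimum `ζ_α`; for `α = 1` the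
infimum `1` is approached as `c → ∞`. -/
theorem le_favardZeta_mul {α b K : ℝ} (hα₀ : 0 < α) (hα₁ : α ≤ 1)
    (h : ∀ c : ℝ, 0 < c → b ≤ (c ^ (1 - α) + 2 * c ^ (-α)) * K) : b ≤ favardZeta α * K := by
  rcases hα₁.eq_or_lt with rfl | hα
  · rw [favardZeta, if_pos rfl]
    have hlim : Tendsto (fun c : ℝ => (c ^ (1 - 1 : ℝ) + 2 * c ^ (-1 : ℝ)) * K) atTop
        (𝓝 ((1 + 2 * 0) * K)) := by
      refine Tendsto.mul_const _ (Tendsto.add ?_ ((tendsto_rpow_neg_atTop one_pos).const_mul _))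
      simp
    rw [mul_zero, add_zero] at hlim
    exact ge_of_tendsto hlim ((eventually_gt_atTop 0).mono h)
  · rw [favardZeta, if_neg hα.ne]
    exact h _ (div_pos (by linarith) (by linarith))

theorem favardZeta_pos {α : ℝ} (hα₀ : 0 < α) (hα₁ : α ≤ 1) : 0 < favardZeta α := by
  rcases hα₁.eq_or_lt with rfl | hα
  · simp [favardZeta]
  · rw [favardZeta, if_neg hα.ne]
    have : 0 < 2 * α / (1 - α) := div_pos (by linarith) (by linarith)
    positivity

/-- In closed form `g_α = 2^{1-α} / ((1-α)^{(1-α)/2} α^{α/2})`, and the denominator is at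
most `1`. -/
theorem two_rpow_le_favardG {α : ℝ} (hα₀ : 0 < α) (hα₁ : α ≤ 1) :
    (2 : ℝ) ^ (1 - α) ≤ favardG α := by
  rcases hα₁.eq_or_lt with rfl | hα
  · simp [favardG, favardZeta]
  · have hβ : 0 < 1 - α := by linarith
    have hc : 0 < 2 * α / (1 - α) := div_pos (by linarith) hβ
    set p := (1 - α) ^ ((1 - α) / 2) with hp
    set q := α ^ (α / 2) with hq
    have hp0 : 0 < p := by positivity
    have hq0 : 0 < q := by positivity
    have hp1 : p ≤ 1 := Real.rpow_le_one hβ.le (by linarith) (by linarith)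
    have hq1 : q ≤ 1 := Real.rpow_le_one hα₀.le hα₁ (by linarith)
    have hp2 : p ^ 2 = (1 - α) ^ (1 - α) := by
      rw [hp, ← Real.rpow_natCast, ← Real.rpow_mul hβ.le]
      norm_num
    have hq2 : q ^ 2 = α ^ α := by
      rw [hq, ← Real.rpow_natCast, ← Real.rpow_mul hα₀.le]
      norm_num
    have hz : favardZeta α * (p ^ 2 * q ^ 2) = 2 ^ (1 - α) := by
      have h1 : favardZeta α = 2 / (1 - α) * (2 * α / (1 - α)) ^ (-α) := by
        rw [favardZeta, if_neg hα.ne, sub_eq_add_neg 1 α, Real.rpow_add (sub_eq_add_neg 1 α ▸ hc),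
          Real.rpow_one, ← sub_eq_add_neg]
        field_simp
        ring
      rw [h1, hp2, hq2, Real.rpow_neg hc.le, Real.div_rpow (by positivity) hβ.le,
        Real.mul_rpow (by norm_num) hα₀.le, Real.rpow_sub hβ, Real.rpow_sub (by norm_num),
        Real.rpow_one, Real.rpow_one]
      have := Real.rpow_pos_of_pos hβ α
      field_simp
    have hz0 := favardZeta_pos hα₀ hα₁
    rw [← hz, favardG, ← hp, ← hq, mul_assoc]
    refine mul_le_mul_of_nonneg_left ?_ hz0.le
    have h1 : p * q ≤ 1 := mul_le_one₀ hp1 hq0.le hq1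
    nlinarith [mul_pos hp0 hq0]

/-- Interpolation between the bounds `‖e^{iθ} - 1‖ ≤ 2` and `‖e^{iθ} - 1‖ ≤ |θ|`. -/
theorem norm_exp_I_mul_sub_one_le_rpow {α : ℝ} (hα₀ : 0 < α) (hα₁ : α ≤ 1) (θ : ℝ) :
    ‖Complex.exp (Complex.I * θ) - 1‖ ≤ 2 ^ (1 - α) * |θ| ^ α := by
  set n := ‖Complex.exp (Complex.I * θ) - 1‖
  have hn : 0 ≤ n := norm_nonneg _
  have h1 : n ≤ |θ| := Real.norm_exp_I_mul_ofReal_sub_one_le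
  have h2 : n ≤ 2 := by
    refine (norm_sub_le _ _).trans ?_
    rw [mul_comm, Complex.norm_exp_ofReal_mul_I, norm_one]
    norm_num
  calc n = n ^ (1 - α) * n ^ α := by
        rw [← Real.rpow_add_of_nonneg hn (by linarith) hα₀.le, sub_add_cancel, Real.rpow_one]
    _ ≤ 2 ^ (1 - α) * |θ| ^ α := by gcongr

/-! ### The Favard norm and the resolvent -/

theorem favardNorm_le_ofReal_iff {𝕜 X : Type*} [RCLike 𝕜] [NormedAddCommGroup X] [NormedSpace 𝕜 X]
    {T : ℝ → X →L[𝕜] X} {α K : ℝ} (hK : 0 ≤ K) {x : X} :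
    favardNorm T α x ≤ ENNReal.ofReal K ↔ ∀ t : ℝ, 0 < t → ‖T t x - x‖ ≤ K * t ^ α := by
  rw [favardNorm, iSup₂_le_iff]
  refine forall₂_congr fun t ht => ?_
  have := Real.rpow_pos_of_pos ht α
  rw [← ofReal_norm, ENNReal.ofReal_le_ofReal_iff hK, norm_smul, RCLike.norm_ofReal,
    abs_of_pos (by positivity), one_div_mul_eq_div, div_le_iff₀ this]

namespace IsContractionSemigroup

variable {𝕜 X : Type*} [RCLike 𝕜] [NormedAddCommGroup X] [NormedSpace 𝕜 X]
  {T : ℝ → X →L[𝕜] X} [NormedSpace ℝ X] [IsScalarTower ℝ 𝕜 X] [CompleteSpace X]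

theorem resolventSup_le_ofReal_iff (hT : IsContractionSemigroup T) {α K : ℝ} (hK : 0 ≤ K) {x : X} :
    resolventSup (semigroupGenerator T) α x ≤ ENNReal.ofReal K ↔
      ∀ (l : ℝ) (hl : 0 < l), l ^ α * ‖l • hT.laplace hl x - x‖ ≤ K := by
  rw [resolventSup, iSup₂_le_iff]
  refine forall₂_congr fun l hl => ?_
  rw [hT.semigroupGenerator_unboundedResolvent hl, ← ofReal_norm,
    ENNReal.ofReal_le_ofReal_iff hK, norm_smul, RCLike.norm_ofReal,
    abs_of_pos (Real.rpow_pos_of_pos hl α)]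

/-- Split `x = l R x - A R x`: the first summand lies in the domain of the generator `A`, so that
`T_t - 1` costs a factor `t` and one application of `A`; on the second one `‖T_t - 1‖ ≤ 2`. -/
theorem norm_apply_sub_self_le_laplace (hT : IsContractionSemigroup T) {l t : ℝ} (hl : 0 < l)
    (ht : 0 ≤ t) (x : X) : ‖T t x - x‖ ≤ (l * t + 2) * ‖l • hT.laplace hl x - x‖ := by
  set r := hT.laplace hl x with hr
  set g := l • r - x with hg
  obtain ⟨h, he⟩ := semigroupGenerator_eq_of_tendsto (hT.tendsto_laplace hl x)
  have h1 : ‖T t r - r‖ ≤ t * ‖g‖ := by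
    simpa only [he] using hT.norm_apply_sub_self_le ⟨_, h⟩ ht
  have h2 : ‖T t g - g‖ ≤ 2 * ‖g‖ := by
    have := (norm_sub_le (T t g) g).trans (add_le_add_left (hT.contraction t ht g) _)
    linarith
  have h3 : T t x - x = l • (T t r - r) - (T t g - g) := by
    rw [hg, map_sub, RCLike.real_smul_eq_coe_smul (K := 𝕜), RCLike.real_smul_eq_coe_smul (K := 𝕜),
      map_smul, smul_sub]
    abel
  rw [h3]
  refine (norm_sub_le _ _).trans ?_
  rw [norm_smul, Real.norm_of_nonneg hl.le, add_mul, mul_assoc]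
  gcongr

/-- The estimate of the Favard norm: `l = c / t` in `norm_apply_sub_self_le_laplace`, and then the
optimal `c`. -/
theorem favardNorm_le_of_resolventSup_le (hT : IsContractionSemigroup T) {α K : ℝ} (hα₀ : 0 < α)
    (hα₁ : α ≤ 1) (hK : 0 ≤ K) {x : X}
    (h : resolventSup (semigroupGenerator T) α x ≤ ENNReal.ofReal K) :
    favardNorm T α x ≤ ENNReal.ofReal (favardZeta α * K) := by
  rw [hT.resolventSup_le_ofReal_iff hK] at h
  rw [favardNorm_le_ofReal_iff (mul_nonneg (favardZeta_pos hα₀ hα₁).le hK)]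
  intro t ht
  rw [mul_assoc]
  refine le_favardZeta_mul hα₀ hα₁ fun c hc => ?_
  have hl : 0 < c / t := div_pos hc ht
  have h1 := hT.norm_apply_sub_self_le_laplace hl ht.le x
  have h2 := h _ hl
  rw [Real.div_rpow hc.le ht.le, div_mul_eq_mul_div,
    div_le_iff₀ (Real.rpow_pos_of_pos ht α)] at h2
  rw [div_mul_cancel₀ _ ht.ne'] at h1
  have hc' := Real.rpow_pos_of_pos hc α
  rw [sub_eq_add_neg 1 α, Real.rpow_add hc, Real.rpow_one, ← add_mul, Real.rpow_neg hc.le, mul_assoc]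
  refine h1.trans (mul_le_mul_of_nonneg_left ?_ (by positivity))
  rwa [← div_eq_inv_mul, le_div_iff₀ hc', mul_comm]

/-- The estimate of the resolvent: integrate `‖T_t x - x‖ ≤ M t^α` against `l e^{-lt} dt`. -/
theorem resolventSup_le_of_favardNorm_le (hT : IsContractionSemigroup T) {α M : ℝ} (hα₀ : 0 < α)
    (hM : 0 ≤ M) {x : X} (h : favardNorm T α x ≤ ENNReal.ofReal M) :
    resolventSup (semigroupGenerator T) α x ≤ ENNReal.ofReal (M * Real.Gamma (α + 1)) := by
  rw [favardNorm_le_ofReal_iff hM] at h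
  have hα : 0 < α + 1 := by linarith
  rw [hT.resolventSup_le_ofReal_iff (mul_nonneg hM (Real.Gamma_pos_of_pos hα).le)]
  intro l hl
  have h1 : l • hT.laplace hl x - x =
      l • ∫ t in Set.Ioi (0 : ℝ), Real.exp (-(l * t)) • (T t x - x) := by
    simp_rw [smul_sub]
    rw [integral_sub (hT.integrableOn_exp_smul hl x)
      ((integrableOn_exp_neg_mul hl).smul_const x), integral_smul_const, integral_exp_neg_mul hl,
      smul_sub, smul_inv_smul₀ hl.ne', hT.laplace_apply]
  have h2 : ‖∫ t in Set.Ioi (0 : ℝ), Real.exp (-(l * t)) • (T t x - x)‖ ≤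
      M * ((1 / l) ^ (α + 1) * Real.Gamma (α + 1)) := by
    rw [← Real.integral_rpow_mul_exp_neg_mul_Ioi hα hl, ← integral_const_mul]
    refine norm_integral_le_of_norm_le ((integrableOn_rpow_mul_exp_neg_mul hα hl).const_mul M) ?_
    filter_upwards [ae_restrict_mem measurableSet_Ioi] with t ht
    rw [norm_smul, Real.norm_eq_abs, Real.abs_exp, add_sub_cancel_right, ← mul_assoc, mul_comm]
    gcongr
    exact h t ht
  rw [h1, norm_smul, Real.norm_of_nonneg hl.le]
  have hl' := Real.rpow_pos_of_pos hl α
  calc l ^ α * (l * ‖∫ t in Set.Ioi (0 : ℝ), Real.exp (-(l * t)) • (T t x - x)‖)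
      ≤ l ^ α * (l * (M * ((1 / l) ^ (α + 1) * Real.Gamma (α + 1)))) := by gcongr
    _ = M * Real.Gamma (α + 1) := by
      rw [Real.div_rpow zero_le_one hl.le, Real.one_rpow, Real.rpow_add hl, Real.rpow_one]
      field_simp

theorem mem_favardSpace_iff (hT : IsContractionSemigroup T) {α : ℝ} (hα₀ : 0 < α)
    (hα₁ : α ≤ 1) (x : X) :
    x ∈ favardSpace T α ↔ resolventSup (semigroupGenerator T) α x < ∞ := by
  constructor
  · intro h
    exact (hT.resolventSup_le_of_favardNorm_le hα₀ ENNReal.toReal_nonneg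
      (ENNReal.ofReal_toReal (ne_of_lt h)).ge).trans_lt ENNReal.ofReal_lt_top
  · intro h
    exact (hT.favardNorm_le_of_resolventSup_le hα₀ hα₁ ENNReal.toReal_nonneg
      (ENNReal.ofReal_toReal h.ne).ge).trans_lt ENNReal.ofReal_lt_top

theorem favardNorm_le_resolventSup (hT : IsContractionSemigroup T) {α : ℝ} (hα₀ : 0 < α)
    (hα₁ : α ≤ 1) (x : X) :
    favardNorm T α x ≤
      ENNReal.ofReal (favardZeta α) * resolventSup (semigroupGenerator T) α x := by
  have hz := favardZeta_pos hα₀ hα₁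
  by_cases h : resolventSup (semigroupGenerator T) α x = ∞
  · rw [h, ENNReal.mul_top (ENNReal.ofReal_pos.2 hz).ne']
    exact le_top
  · refine (hT.favardNorm_le_of_resolventSup_le hα₀ hα₁ ENNReal.toReal_nonneg
      (ENNReal.ofReal_toReal h).ge).trans_eq ?_
    rw [ENNReal.ofReal_mul hz.le, ENNReal.ofReal_toReal h]

end IsContractionSemigroup

/-! ### The isometry property of the spectral integral -/

namespace ProjectionValuedMeasure

variable {𝓗 : Type*} [NormedAddCommGroup 𝓗] [InnerProductSpace ℂ 𝓗] [CompleteSpace 𝓗]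
  (E : ProjectionValuedMeasure 𝓗)

theorem simpleIntegral_const_one : E.simpleIntegral (SimpleFunc.const ℝ 1) = 1 := by
  have h : ⇑(SimpleFunc.const ℝ (1 : ℂ)) ⁻¹' {1} = Set.univ := by
    ext
    simp
  rw [simpleIntegral, SimpleFunc.range_const, Finset.sum_singleton, h, E.univ, one_smul]

theorem simpleIntegral_zero : E.simpleIntegral 0 = 0 := by
  rw [← sub_self (0 : SimpleFunc ℝ ℂ), simpleIntegral_sub, sub_self]

/-- The isometry property, relative to a simple function `ψ`; it follows from the one for simple
functions because the approximants `φ_n` converge to `f` in `L²`. The cases `ψ = 0` and `ψ = 1`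
give the norms of `∫ f dE x` and of `∫ f dE x - x`. -/
theorem enorm_integral_sub_simpleIntegral {f : ℝ → ℂ} (hf : Measurable f)
    (x : (E.integral f hf).domain) (ψ : SimpleFunc ℝ ℂ) :
    ‖E.integral f hf x - E.simpleIntegral ψ (x : 𝓗)‖ₑ = eLpNorm (f - ⇑ψ) 2 (E.measure (x : 𝓗)) := by
  set μ := E.measure (x : 𝓗)
  set φ := simpleApprox f hf
  have hfin : eLpNorm f 2 μ < ∞ := by
    have h : eLpNorm f 2 μ ^ 2 < ∞ := by rw [eLpNorm_sq]; exact x.2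
    exact (ENNReal.pow_lt_top_iff.1 h).resolve_right two_ne_zero
  have hlim : Tendsto (fun n => eLpNorm (⇑(φ n) - f) 2 μ) atTop (𝓝 0) :=
    SimpleFunc.tendsto_approxOn_Lp_eLpNorm hf (Set.mem_univ 0) (by simp) (by simp)
      (by simpa using hfin)
  have hint : Tendsto (fun n => eLpNorm (⇑(φ n) - ⇑ψ) 2 μ) atTop
      (𝓝 ‖E.integral f hf x - E.simpleIntegral ψ (x : 𝓗)‖ₑ) := by
    have h := ((tendsto_nhds_limUnder (E.exists_tendsto_simpleIntegral f hf x x.2)).sub_const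
      (E.simpleIntegral ψ (x : 𝓗))).enorm
    refine h.congr fun n => ?_
    rw [← sub_apply, ← E.simpleIntegral_sub, E.enorm_simpleIntegral, SimpleFunc.coe_sub]
  have hm : ∀ n, AEStronglyMeasurable (⇑(φ n) - f) μ := fun n =>
    ((φ n).measurable.sub hf).aestronglyMeasurable
  have hmψ : AEStronglyMeasurable (f - ⇑ψ) μ := (hf.sub ψ.measurable).aestronglyMeasurable
  have hmφ : ∀ n, AEStronglyMeasurable (⇑(φ n) - ⇑ψ) μ := fun n =>
    ((φ n).measurable.sub ψ.measurable).aestronglyMeasurable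
  refine le_antisymm ?_ ?_
  · refine le_of_tendsto_of_tendsto' hint (by simpa using hlim.add_const (eLpNorm (f - ⇑ψ) 2 μ))
      fun n => ?_
    rw [← sub_add_sub_cancel (⇑(φ n)) f ⇑ψ]
    exact eLpNorm_add_le (hm n) hmψ (by norm_num)
  · refine ge_of_tendsto' (by simpa using hint.add hlim) fun n => ?_
    rw [← sub_sub_sub_cancel_left (⇑ψ) f (⇑(φ n))]
    exact eLpNorm_sub_le (hmφ n) (hm n) (by norm_num)

theorem enorm_integral {f : ℝ → ℂ} (hf : Measurable f) (x : (E.integral f hf).domain) :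
    ‖E.integral f hf x‖ₑ = eLpNorm f 2 (E.measure (x : 𝓗)) := by
  simpa [E.simpleIntegral_zero] using E.enorm_integral_sub_simpleIntegral hf x 0

theorem enorm_boundedIntegral_sub_self {f : ℝ → ℂ} (hf : Measurable f) (hb : ∀ s, ‖f s‖ ≤ 1)
    (x : 𝓗) : ‖E.boundedIntegral f hf hb x - x‖ₑ = eLpNorm (fun s => f s - 1) 2 (E.measure x) := by
  have h := E.enorm_integral_sub_simpleIntegral hf ⟨x, E.mem_integralDomain_of_bounded hb x⟩
    (SimpleFunc.const ℝ 1)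
  rw [E.simpleIntegral_const_one] at h
  exact h

end ProjectionValuedMeasure

section UnitaryGroup

variable {𝓗 : Type*} [NormedAddCommGroup 𝓗] [InnerProductSpace ℂ 𝓗] [CompleteSpace 𝓗]

/-- By the isometry property the claim reduces to the scalar inequality
`‖e^{-its} - 1‖ ≤ 2^{1-α} t^α |s|^α` for real `s`. -/
theorem favardNorm_schrodingerGroup_le {α : ℝ} (hα₀ : 0 < α) (hα₁ : α ≤ 1) (H : 𝓗 →ₗ.[ℂ] 𝓗)
    (x : (absPow H α).domain) :
    favardNorm (schrodingerGroup H) α (x : 𝓗) ≤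
      ENNReal.ofReal (favardG α) * ‖absPow H α x‖ₑ := by
  have h2 : (0 : ℝ) ≤ 2 ^ (1 - α) := by positivity
  have key : favardNorm (schrodingerGroup H) α (x : 𝓗) ≤
      ENNReal.ofReal (2 ^ (1 - α) * ‖absPow H α x‖) := by
    rw [favardNorm_le_ofReal_iff (by positivity)]
    intro t ht
    have ht' := Real.rpow_nonneg ht.le α
    rw [← ENNReal.ofReal_le_ofReal_iff (by positivity), ofReal_norm, mul_right_comm,
      ENNReal.ofReal_mul (by positivity), ofReal_norm, schrodingerGroup,
      ProjectionValuedMeasure.enorm_boundedIntegral_sub_self]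
    refine (eLpNorm_le_mul_eLpNorm_of_ae_le_mul (Eventually.of_forall fun s => ?_) 2).trans_eq
      (congrArg _ ((spectralMeasure H).enorm_integral _ x).symm)
    have h := norm_exp_I_mul_sub_one_le_rpow hα₀ hα₁ (-(t * s))
    rw [abs_neg, abs_mul, abs_of_pos ht, Real.mul_rpow ht.le (abs_nonneg s), ← mul_assoc] at h
    rw [Complex.norm_real, Real.norm_of_nonneg (by positivity)]
    refine le_of_eq_of_le ?_ h
    congr 3
    push_cast
    ring
  refine key.trans ?_
  rw [ENNReal.ofReal_mul h2, ofReal_norm]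
  gcongr
  exact two_rpow_le_favardG hα₀ hα₁

end UnitaryGroup

theorem mainTheorem9 (α : ℝ) (hα₀ : 0 < α) (hα₁ : α ≤ 1) :
    (∀ (𝕜 : Type*) (X : Type*) [RCLike 𝕜] [NormedAddCommGroup X] [NormedSpace 𝕜 X]
        [CompleteSpace X] (T : ℝ → X →L[𝕜] X), IsContractionSemigroup T →
        (∀ l : ℝ, 0 < l → (l : 𝕜) ∈ unboundedResolventSet (semigroupGenerator T)) ∧
        ∀ x : X,
          (x ∈ favardSpace T α ↔ resolventSup (semigroupGenerator T) α x < ∞) ∧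
          favardNorm T α x ≤
            ENNReal.ofReal (favardZeta α) * resolventSup (semigroupGenerator T) α x) ∧
    (∀ (𝓗 : Type*) [NormedAddCommGroup 𝓗] [InnerProductSpace ℂ 𝓗] [CompleteSpace 𝓗]
        (H : 𝓗 →ₗ.[ℂ] 𝓗), IsSelfAdjoint H →
        ∀ x : (absPow H α).domain,
          (x : 𝓗) ∈ favardSpace (schrodingerGroup H) α ∧
          favardNorm (schrodingerGroup H) α (x : 𝓗) ≤
            ENNReal.ofReal (favardG α) * ‖absPow H α x‖ₑ) := by
  refine ⟨fun 𝕜 X _ _ _ _ T hT => ?_, fun 𝓗 _ _ _ H _ x => ?_⟩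
  · let _ : NormedSpace ℝ X := NormedSpace.restrictScalars ℝ 𝕜 X
    have : IsScalarTower ℝ 𝕜 X := IsScalarTower.of_algebraMap_smul fun r x => rfl
    exact ⟨fun l hl => ⟨hT.laplace hl, hT.isResolventAt_laplace hl⟩, fun x =>
      ⟨hT.mem_favardSpace_iff hα₀ hα₁ x, hT.favardNorm_le_resolventSup hα₀ hα₁ x⟩⟩
  · have h := favardNorm_schrodingerGroup_le hα₀ hα₁ H x
    exact ⟨h.trans_lt (ENNReal.mul_lt_top ENNReal.ofReal_lt_top enorm_lt_top), h⟩
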